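/- Let $H$ be a finite group, and for $T\subseteq H$ put $\underline T=\sum_{t\in T}t\in\mathbb{Q}H$. A subalgebra $\mathcal A$ of $\mathbb{Q}H$ is a Schur ring (S-ring) over $H$ if there is a partition $\mathrm{Bsets}(\mathcal A)$ of $H$ into nonempty sets that contains $\{1_H\}$, is closed under $T\mapsto T^{-1}$, and is such that $\{\underline T\mid T\in\mathrm{Bsets}(\mathcal A)\}$ is a linear basis of $\mathcal A$. If $H$ is a $p$-group and every $T\in\mathrm{Bsets}(\mathcal A)$ has size a power of $p$, then $\mathcal A$ is a $p$-S-ring. An S-ring $\mathcal A$ is Schurian if there is a subgroup $G\le\mathrm{Sym}(H)$ containing all right translations of $H$ such that $\mathcal A$ is spanned by the elements $\underline T$, where $T$ runs over the orbits on $H$ of the point stabilizer $G_{1_H}$. For an odd prime $p$, a sequence $(x_1,\dots,x_{p-1})$ in $\mathbb{Z}_p=\mathbb{Z}/p\mathbb{Z}$ is suitable if $\{x_1,\dots,x_{p-1}\}=\mathbb{Z}_p\setminus\{l\}$ for some $l\in\mathbb{Z}_p$, $x_1=0$, and $x_i+i=x_{p-i}$ in $\mathbb{Z}_p$ for $1\le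 i\le\frac{p-1}{2}$. Let $p>3$ be a prime with $p\equiv 3\pmod 4$, let $H_1=\langle a,b\mid a^{p^2}=b^p=1,\ ab=ba^{p+1}\rangle$, and let $L=\langle a^p,b\rangle\le H_1$. Then: 1. $|H_1|=p^3$. 2. There exists a suitable sequence in $\mathbb{Z}_p$ with $x_2=\frac{p+1}{2}$ and $x_{p-1}=1$ and, if $p>7$, also $x_3=p-1$. 3. For every suitable sequence $(x_1,\dots,x_{p-1})$ in $\mathbb{Z}_p$ with $x_2=\frac{p+1}{2}$, put $T_i=a^i\langle ba^{px_i}\rangle$ for $1\le i\le p-1$. The vector space $\mathcal A$ spanned by the elements $\underline T$ with $$T\in\{\{l\}\mid l\in L\}\cup\{T_ia^{pj}\mid 1\le i\le p-1,\ 0\le j\le p-1\}$$ is a $p$-S-ring over $H_1$ whose set $\mathrm{Bsets}(\mathcal A)$ is this family of sets, and $\mathcal A$ is not Schurian. -/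

import Mathlib

open scoped Pointwise MonoidAlgebra

noncomputable section

/-- The relators of `⟨a, b | a^(p^2) = b^p = 1, a b = b a^(p+1)⟩`; generator `0` is `a`, generator
`1` is `b`. -/
def H1Rels (p : ℕ) : Set (FreeGroup (Fin 2)) :=
  {FreeGroup.of 0 ^ (p ^ 2),
   FreeGroup.of 1 ^ p,
   (FreeGroup.of 0 * FreeGroup.of 1) * (FreeGroup.of 1 * FreeGroup.of 0 ^ (p + 1))⁻¹}

/-- The group `H₁ = ⟨a, b | a^(p^2) = b^p = 1, a b = b a^(p+1)⟩`. -/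
abbrev H1 (p : ℕ) : Type := PresentedGroup (H1Rels p)

/-- The generator `a` of `H₁`. -/
def H1.a (p : ℕ) : H1 p := PresentedGroup.of 0

/-- The generator `b` of `H₁`. -/
def H1.b (p : ℕ) : H1 p := PresentedGroup.of 1

section SchurRings

variable {H : Type*} [Group H]

/-- The element `∑_{t ∈ T} t` of the group algebra `ℚH` (used for finite `H`). -/
def simpleQuantity (T : Set H) : MonoidAlgebra ℚ H :=
  ∑ᶠ t ∈ T, MonoidAlgebra.single t (1 : ℚ)

/-- The vector space spanned by the elements `∑_{t ∈ T} t`, `T ∈ B`. -/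
def spanOf (B : Set (Set H)) : Submodule ℚ (MonoidAlgebra ℚ H) :=
  Submodule.span ℚ (simpleQuantity '' B)

/-- `B` is a partition of the finite group `H` that exhibits the subalgebra `A` of `ℚH`
as a Schur ring, i.e. `B = Bsets(A)`. -/
structure IsBsets (A : Subalgebra ℚ (MonoidAlgebra ℚ H)) (B : Set (Set H)) : Prop where
  finite : Finite H
  isPartition : Setoid.IsPartition B
  linearIndependent : LinearIndependent ℚ (fun T : B => simpleQuantity (T : Set H))
  span_eq : spanOf B = Subalgebra.toSubmodule A
  one_mem : {1} ∈ B
  inv_mem : ∀ T ∈ B, T⁻¹ ∈ B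

/-- The subalgebra `A` of `ℚH` is a Schur ring over the finite group `H`. -/
def IsSchurRing (A : Subalgebra ℚ (MonoidAlgebra ℚ H)) : Prop :=
  ∃ B : Set (Set H), IsBsets A B

/-- `A` is a `p`-Schur ring: `H` is a finite `p`-group, `A` is a Schur ring over `H`, and the
size of every basic set is a power of `p`. -/
def IsPSchurRing (p : ℕ) (A : Subalgebra ℚ (MonoidAlgebra ℚ H)) : Prop :=
  IsPGroup p H ∧ IsSchurRing A ∧ ∀ B : Set (Set H), IsBsets A B → ∀ T ∈ B, ∃ n : ℕ, T.ncard = p ^ n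

/-- The orbits on `H` of the stabilizer `G_1` of the identity element in `G ≤ Sym(H)`. -/
def stabilizerOrbits (G : Subgroup (Equiv.Perm H)) : Set (Set H) :=
  Set.range fun h : H => MulAction.orbit (MulAction.stabilizer G (1 : H)) h

/-- The transitivity module `V(H, G_1)`. -/
def transitivityModule (G : Subgroup (Equiv.Perm H)) : Submodule ℚ (MonoidAlgebra ℚ H) :=
  spanOf (stabilizerOrbits G)

/-- `A` is Schurian: it is the transitivity module of some `G ≤ Sym(H)` that contains the right
regular representation of `H`. -/
def IsSchurian (A : Subalgebra ℚ (MonoidAlgebra ℚ H)) : Prop :=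
  ∃ G : Subgroup (Equiv.Perm H),
    (∀ h : H, Equiv.mulRight h ∈ G) ∧ Subalgebra.toSubmodule A = transitivityModule G

end SchurRings

/-- The sequence `x 1, …, x (p - 1)` in `ℤ/p` is suitable (other values of `x` are irrelevant). -/
structure IsSuitable (p : ℕ) (x : ℕ → ZMod p) : Prop where
  image_eq : ∃ l : ZMod p, x '' Set.Icc 1 (p - 1) = {l}ᶜ
  first : x 1 = 0
  add_eq : ∀ i : ℕ, 1 ≤ i → i ≤ (p - 1) / 2 → x i + (i : ZMod p) = x (p - i)

/-- The subgroup `L = ⟨a^p, b⟩` of `H₁`. -/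
def H1.L (p : ℕ) : Subgroup (H1 p) := Subgroup.closure {H1.a p ^ p, H1.b p}

/-- The set `T_i = a^i ⟨b a^(p x_i)⟩`. -/
def H1.T (p : ℕ) (x : ℕ → ZMod p) (i : ℕ) : Set (H1 p) :=
  {H1.a p ^ i} * (Subgroup.zpowers (H1.b p * H1.a p ^ (p * (x i).val)) : Set (H1 p))

/-- The family `{ {l} | l ∈ L } ∪ { T_i a^(p j) | 1 ≤ i ≤ p - 1, 0 ≤ j ≤ p - 1 }`. -/
def H1.basicSets (p : ℕ) (x : ℕ → ZMod p) : Set (Set (H1 p)) :=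
  {S | ∃ l ∈ H1.L p, S = {l}} ∪
  {S | ∃ i j : ℕ, 1 ≤ i ∧ i ≤ p - 1 ∧ j ≤ p - 1 ∧ S = H1.T p x i * {H1.a p ^ (p * j)}}

end

/-!
`H₁` is identified with `ℤ/p² × ℤ/p` under `(u, j) (u', j') = (u + u' + p u j', j + j')`, where
`(u, j)` stands for `b ^ j a ^ u` (`coord`). In each nontrivial coset `a ^ r L` the basic sets are
then the lines `{(u + p y(r) t, t) | t}` of slope `y(r) = x_r + r`, and the suitability of `x` says
that `y` is injective off `0` and satisfies `y(-r) = y(r) - r` (`IsSlope`).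

**Schur ring.** Multiplication by a point of `L` permutes the lines of a coset, and inversion turns
lines of slope `y(r)` into lines of slope `y(r) - r = y(-r)`. The product of a line in `a ^ r L` and
a line in `a ^ s L` with `r + s ≠ 0` is the whole coset `a ^ (r + s) L`, each point attained once,
because `y(r) ≠ y(s) + r`: otherwise `y(-r) = y(s)` (`line_mul_line_eq_sum`). If `r + s = 0`, the
product lies in `ℚL`, which is spanned by basic sets.

**Not Schurian.** A partition is determined by the span of its simple quantities
(`eq_of_spanOf_eq`), so the orbits of a point stabilizer that realizes the Schur ring would be the
points of `L` and the lines. Some `g` in the stabilizer moves `a`; let `t(i)` be the amount by which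
it moves `a ^ i` along its line. Quotients of two points stay on the same line, which yields
`t(j) (y(j) - y(j - i)) = t(i) (y(i) - y(i - j))` for distinct `i, j ≠ 0`. From `y(1) = 1` and
`y(2) = 5 / 2` it follows that `t(-1) = 3 t(1)`, and, by induction, that `t(-n)` is proportional to
`1 - (-3) ^ n`. For `n = p - 1` this vanishes by Fermat, so `t(1) = t(-(p - 1)) = 0`, contrary to
the choice of `g` (`eq_zero_of_slope_relations`).

**Existence.** A suitable sequence pairs all residues but one so that each difference
`1, …, (p - 1) / 2` occurs once. The pairs `{(s - i) / 2, (s + i) / 2}` with a few values of the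
centre `s / 2` work, with one exceptional pair, separately for `p = 12 m + 7` and `p = 12 m + 11`
(`exists_isSuitable`).
-/

/-! ### Simple quantities of a partition -/

section Partitions

variable {H : Type*}

theorem coeff_simpleQuantity [Finite H] (T : Set H) (h : H) :
    (simpleQuantity T).coeff h = T.indicator 1 h := by
  classical
  rw [simpleQuantity, finsum_mem_eq_finite_toFinset_sum _ (Set.toFinite T)]
  simp [Finsupp.single_apply, Set.indicator_apply]

theorem simpleQuantity_singleton (h : H) :
    simpleQuantity {h} = MonoidAlgebra.single h (1 : ℚ) := by
  simp [simpleQuantity]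

theorem simpleQuantity_range {ι : Type*} [Fintype ι] {f : ι → H} (hf : f.Injective) :
    simpleQuantity (Set.range f) = ∑ i, MonoidAlgebra.single (f i) (1 : ℚ) := by
  rw [simpleQuantity, finsum_mem_range hf, finsum_eq_sum_of_fintype]

/-- Two sets of a partition that share a point coincide. -/
theorem Setoid.IsPartition.eq_of_mem {α : Type*} {B : Set (Set α)} (hB : Setoid.IsPartition B)
    {S T : Set α} (hS : S ∈ B) (hT : T ∈ B) {a : α} (haS : a ∈ S) (haT : a ∈ T) : S = T :=
  (hB.2 a).unique ⟨hS, haS⟩ ⟨hT, haT⟩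

theorem coeff_eq_of_mem_spanOf [Finite H] {B : Set (Set H)} (hB : Setoid.IsPartition B)
    {f : MonoidAlgebra ℚ H} (hf : f ∈ spanOf B) {T : Set H} (hT : T ∈ B) {h k : H}
    (hh : h ∈ T) (hk : k ∈ T) : f.coeff h = f.coeff k := by
  classical
  induction hf using Submodule.span_induction with
  | mem f hf =>
    obtain ⟨S, hS, rfl⟩ := hf
    have hiff : h ∈ S ↔ k ∈ S :=
      ⟨fun h' => hB.eq_of_mem hT hS hh h' ▸ hk, fun h' => hB.eq_of_mem hT hS hk h' ▸ hh⟩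
    simp [coeff_simpleQuantity, Set.indicator_apply, hiff]
  | zero => simp
  | add f g _ _ hf hg => simp [hf, hg]
  | smul c f _ hf => simp [hf]

theorem subset_of_spanOf_le [Finite H] {B C : Set (Set H)} (hC : Setoid.IsPartition C)
    (h : spanOf B ≤ spanOf C) {S T : Set H} (hS : S ∈ B) (hT : T ∈ C) {a : H} (haS : a ∈ S)
    (haT : a ∈ T) : T ⊆ S := by
  classical
  intro b hb
  have := coeff_eq_of_mem_spanOf hC (h (Submodule.subset_span ⟨S, hS, rfl⟩)) hT haT hb
  by_contra hbS
  simp [coeff_simpleQuantity, haS, hbS] at this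

/-- A partition is determined by the span of its simple quantities, because the elements of the
span are exactly the functions constant on its classes. -/
theorem eq_of_spanOf_eq [Finite H] {B C : Set (Set H)} (hB : Setoid.IsPartition B)
    (hC : Setoid.IsPartition C) (h : spanOf B = spanOf C) : B = C := by
  have key : ∀ {B C : Set (Set H)}, Setoid.IsPartition B → Setoid.IsPartition C →
      spanOf B = spanOf C → B ⊆ C := by
    intro B C hB hC h S hS
    obtain ⟨a, ha⟩ := Setoid.nonempty_of_mem_partition hB hS
    obtain ⟨T, ⟨hT, haT⟩, -⟩ := hC.2 a
    rwa [(subset_of_spanOf_le hB h.ge hT hS haT ha).antisymm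
      (subset_of_spanOf_le hC h.le hS hT ha haT)]
  exact (key hB hC h).antisymm (key hC hB h.symm)

theorem linearIndependent_simpleQuantity [Finite H] {B : Set (Set H)}
    (hB : Setoid.IsPartition B) :
    LinearIndependent ℚ (fun T : B => simpleQuantity (T : Set H)) := by
  classical
  rw [linearIndependent_iff']
  intro s g hg T hT
  obtain ⟨a, ha⟩ := Setoid.nonempty_of_mem_partition hB T.2
  have h := congrArg (fun f => f.coeff a) hg
  simp only [MonoidAlgebra.coeff_sum, Finsupp.finsetSum_apply, MonoidAlgebra.coeff_smul,
    Finsupp.smul_apply, coeff_simpleQuantity, MonoidAlgebra.coeff_zero, Finsupp.zero_apply] at h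
  rw [Finset.sum_eq_single T] at h
  · simpa [ha] using h
  · intro S _ hST
    have : a ∉ (S : Set H) := fun haS => hST (Subtype.ext (hB.eq_of_mem S.2 T.2 haS ha))
    simp [this]
  · exact fun h' => absurd hT h'

variable [Group H]

theorem isPartition_stabilizerOrbits (G : Subgroup (Equiv.Perm H)) :
    Setoid.IsPartition (stabilizerOrbits G) := by
  have : stabilizerOrbits G =
      (MulAction.orbitRel (MulAction.stabilizer G (1 : H)) H).classes := by
    ext S
    constructor
    · rintro ⟨h, rfl⟩
      exact ⟨h, rfl⟩
    · rintro ⟨h, rfl⟩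
      exact ⟨h, rfl⟩
  rw [this]
  exact Setoid.isPartition_classes _

/-- A permutation group containing the right translations preserves the relation "`k h⁻¹` and
`k' h'⁻¹` lie in the same orbit of the point stabilizer". -/
theorem apply_mul_inv_mem_orbit {G : Subgroup (Equiv.Perm H)}
    (hG : ∀ h : H, Equiv.mulRight h ∈ G) {g : Equiv.Perm H} (hg : g ∈ G) (h k : H) :
    g k * (g h)⁻¹ ∈ MulAction.orbit (MulAction.stabilizer G (1 : H)) (k * h⁻¹) := by
  let f : G := ⟨Equiv.mulRight (g h)⁻¹ * g * Equiv.mulRight h,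
    G.mul_mem (G.mul_mem (hG _) hg) (hG _)⟩
  have hf : f ∈ MulAction.stabilizer G (1 : H) := by
    change g (1 * h) * (g h)⁻¹ = 1
    simp
  refine ⟨⟨f, hf⟩, ?_⟩
  change g (k * h⁻¹ * h) * (g h)⁻¹ = _
  simp

end Partitions

/-! ### An overdetermined linear system over `ℤ/p` -/

theorem natCast_ne_zero_of_lt {p n : ℕ} (h0 : n ≠ 0) (hn : n < p) : (n : ZMod p) ≠ 0 := by
  rw [Ne, ZMod.natCast_eq_zero_iff]
  exact Nat.not_dvd_of_pos_of_lt (Nat.pos_of_ne_zero h0) hn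

/-- The relations between `±1` and the other indices determine `t` up to a scalar: `t (-n)` is
proportional to `1 - (-3) ^ n`. Since `(-3) ^ (p - 1) = 1`, the index `-(p - 1) = 1` gets the
value `0`. -/
theorem eq_zero_of_slope_relations {p : ℕ} [Fact p.Prime] (hp3 : 3 < p) {y t : ZMod p → ZMod p}
    (hinj : ∀ i j, i ≠ 0 → j ≠ 0 → y i = y j → i = j) (hneg : ∀ i, i ≠ 0 → y (-i) = y i - i)
    (h1 : y 1 = 1) (h2 : 2 * y 2 = 5)
    (hrel : ∀ i j, i ≠ 0 → j ≠ 0 → i ≠ j →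
      t j * (y j - y (j - i)) = t i * (y i - y (i - j))) : t 1 = 0 := by
  have ne : ∀ n : ℕ, n ≠ 0 → n < p → (n : ZMod p) ≠ 0 := fun n => natCast_ne_zero_of_lt
  have two : (2 : ZMod p) ≠ 0 := by exact_mod_cast ne 2 (by omega) (by omega)
  have three : (3 : ZMod p) ≠ 0 := by exact_mod_cast ne 3 (by omega) (by omega)
  have four : (4 : ZMod p) ≠ 0 := by
    rw [show (4 : ZMod p) = 2 * 2 by norm_num]
    exact mul_ne_zero two two
  have m1 : y (-1) = 0 := by rw [hneg 1 one_ne_zero, h1, sub_self]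
  have ht : t (-1) = 3 * t 1 := by
    have h := hrel 1 (-1) one_ne_zero (neg_ne_zero.2 one_ne_zero) (fun h => two (by
      linear_combination h))
    rw [show (-1 - 1 : ZMod p) = -2 by ring, show (1 - -1 : ZMod p) = 2 by ring, hneg 2 two, m1,
      h1] at h
    linear_combination (-2) * h - (t (-1) - t 1) * h2
  by_contra ht1
  have ht1' : t (-1) ≠ 0 := by
    rw [ht]
    exact mul_ne_zero three ht1
  have key : ∀ n : ℕ, 1 ≤ n → n ≤ p - 1 → 4 * t (-(n : ZMod p)) = (1 - (-3) ^ n) * t (-1) := by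
    intro n hn
    induction n, hn using Nat.le_induction with
    | base =>
      intro _
      norm_num
    | succ n hn ih =>
      intro hnp
      specialize ih (by omega)
      have n0 := ne n (by omega) (by omega)
      have n1 := ne (n + 1) (by omega) (by omega)
      push_cast at n1 ⊢
      have e1 := hrel 1 (-n) one_ne_zero (neg_ne_zero.2 n0) (fun h => n1 (by
        linear_combination h))
      rw [show (-n - 1 : ZMod p) = -(n + 1) by ring, show (1 - -n : ZMod p) = n + 1 by ring,
        hneg _ n0, hneg _ n1, h1] at e1
      have e2 := hrel (-1) (-(n + 1)) (neg_ne_zero.2 one_ne_zero) (neg_ne_zero.2 n1)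
        (fun h => n0 (by linear_combination h))
      rw [show (-(n + 1) - -1 : ZMod p) = -n by ring, show (-1 - -(n + 1) : ZMod p) = n by ring,
        m1] at e2
      -- By `ih` and `ht`, `e1` is a linear recursion for `y (n + 1)`, and with it `e2` determines
      -- `t (-(n + 1))`; the factor cancelled is nonzero by injectivity.
      have hD : y (-(n + 1)) - y (-n) ≠ 0 := fun h =>
        one_ne_zero (α := ZMod p) (by
          linear_combination -hinj _ _ (neg_ne_zero.2 n1) (neg_ne_zero.2 n0) (sub_eq_zero.1 h))
      refine mul_right_cancel₀ hD ?_
      rw [hneg _ n0, hneg _ n1] at e2 ⊢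
      rw [pow_succ]
      linear_combination 4 * e2 - 12 * e1 + 3 * (y n + 1 - y (n + 1)) * ih +
        4 * (1 - y (n + 1)) * ht
  -- At `n = p - 1` the index `-n` wraps around to `1`.
  have h := key (p - 1) (by omega) le_rfl
  rw [ZMod.pow_card_sub_one_eq_one (neg_ne_zero.2 three), sub_self, zero_mul,
    Nat.cast_sub (by omega), CharP.cast_eq_zero, Nat.cast_one, zero_sub, neg_neg] at h
  exact ht1 ((mul_eq_zero.1 h).resolve_left four)

/-! ### Suitable sequences -/

/-- A suitable sequence is given by disjoint pairs `{X i, Y i}`, `1 ≤ i ≤ n`, of residues with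
`Y i - X i = i` that cover all residues but one. -/
theorem isSuitable_of_pairs {p n l : ℕ} (hp : p = 2 * n + 1) (hn : 1 ≤ n) (hl : l < p)
    {X Y : ℕ → ℕ} (h1 : X 1 = 0)
    (hlt : ∀ i, 1 ≤ i → i ≤ n → X i < p ∧ Y i < p ∧ X i ≠ l ∧ Y i ≠ l)
    (hXY : ∀ i, 1 ≤ i → i ≤ n → X i + i = Y i ∨ X i + i = Y i + p)
    (hsurj : ∀ v, v < p → v ≠ l → ∃ i, 1 ≤ i ∧ i ≤ n ∧ (X i = v ∨ Y i = v)) :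
    IsSuitable p (fun i => if i ≤ n then (X i : ZMod p) else (Y (p - i) : ZMod p)) where
  image_eq := by
    have : NeZero p := ⟨by omega⟩
    have hne : ∀ v, v < p → v ≠ l → (v : ZMod p) ≠ l := by
      intro v hv hvl h
      have h' := congrArg ZMod.val h
      rw [ZMod.val_cast_of_lt hv, ZMod.val_cast_of_lt hl] at h'
      exact hvl h'
    refine ⟨(l : ZMod p), Set.ext fun v => ⟨?_, fun hv => ?_⟩⟩
    · rintro ⟨i, ⟨hi1, hi2⟩, rfl⟩
      by_cases hi : i ≤ n
      · simpa [hi] using hne _ (hlt i hi1 hi).1 (hlt i hi1 hi).2.2.1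
      · have := hlt (p - i) (by omega) (by omega)
        simpa [hi] using hne _ this.2.1 this.2.2.2
    · obtain ⟨i, hi1, hi2, hi | hi⟩ := hsurj v.val (ZMod.val_lt v) (by
        rintro rfl
        simp at hv)
      · exact ⟨i, ⟨hi1, by omega⟩, by simp [hi2, hi]⟩
      · refine ⟨p - i, ⟨by omega, by omega⟩, ?_⟩
        have h' : ¬ p - i ≤ n := by omega
        have h'' : p - (p - i) = i := by omega
        simp [h', h'', hi]
  first := by simp [hn, h1]
  add_eq := by
    intro i hi1 hi2
    have hi : i ≤ n := by omega
    have h' : ¬ p - i ≤ n := by omega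
    have h'' : p - (p - i) = i := by omega
    simp only [hi, h', h'', if_true, if_false]
    obtain h | h := hXY i hi1 hi
    · exact_mod_cast congrArg (Nat.cast : ℕ → ZMod p) h
    · simpa using congrArg (Nat.cast : ℕ → ZMod p) h

/-- The pairs of odd difference are centred at `1 / 2` up to the difference `4 m + 1` and at
`3 / 2` from `4 m + 5` on, the pairs of even difference at `(p + 3) / 2`; the pair
`{2 m + 2, 6 m + 5}` fills the gap, and `2 m + 3` is left over. -/
theorem exists_isSuitable_twelve_mul_add_seven (m : ℕ) :
    ∃ x : ℕ → ZMod (12 * m + 7), IsSuitable (12 * m + 7) x ∧ x 2 = ((6 * m + 4 : ℕ) : ZMod _) ∧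
      (m ≠ 0 → x 3 = ((12 * m + 6 : ℕ) : ZMod _)) := by
  refine ⟨_, isSuitable_of_pairs (n := 6 * m + 3) (l := 2 * m + 3)
    (X := fun i => if i % 2 = 0 then 6 * m + 5 - i / 2 else if i = 1 then 0
      else if i ≤ 4 * m + 1 then 12 * m + 7 - i / 2 else if i = 4 * m + 3 then 2 * m + 2
      else 12 * m + 8 - i / 2)
    (Y := fun i => if i % 2 = 0 then 6 * m + 5 + i / 2 else if i ≤ 4 * m + 1 then i / 2 + 1
      else if i = 4 * m + 3 then 6 * m + 5 else i / 2 + 2)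
    (by ring) (by omega) (by omega) (by simp) ?_ ?_ ?_, ?_, ?_⟩
  · intro i _ _
    split_ifs <;> omega
  · intro i _ _
    split_ifs <;> omega
  · intro v hv hvl
    by_cases c1 : v ≤ 2 * m + 1
    · by_cases c0 : v = 0
      · exact ⟨1, by omega, by omega, by simp [c0]⟩
      · exact ⟨2 * v - 1, by omega, by omega, by right; split_ifs <;> omega⟩
    by_cases c2 : v = 2 * m + 2
    · exact ⟨4 * m + 3, by omega, by omega, by left; split_ifs <;> omega⟩
    by_cases c3 : v ≤ 3 * m + 3
    · exact ⟨2 * v - 3, by omega, by omega, by right; split_ifs <;> omega⟩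
    by_cases c4 : v ≤ 6 * m + 4
    · exact ⟨2 * (6 * m + 5 - v), by omega, by omega, by left; split_ifs <;> omega⟩
    by_cases c5 : v = 6 * m + 5
    · exact ⟨4 * m + 3, by omega, by omega, by right; split_ifs <;> omega⟩
    by_cases c6 : v ≤ 9 * m + 6
    · exact ⟨2 * (v - (6 * m + 5)), by omega, by omega, by right; split_ifs <;> omega⟩
    by_cases c7 : v ≤ 10 * m + 6
    · exact ⟨2 * (12 * m + 8 - v) + 1, by omega, by omega, by left; split_ifs <;> omega⟩
    · exact ⟨2 * (12 * m + 7 - v) + 1, by omega, by omega, by left; split_ifs <;> omega⟩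
  · have : 2 ≤ 6 * m + 3 := by omega
    simp [this]
  · intro hm
    have h3 : 3 ≤ 6 * m + 3 := by omega
    have h3' : 3 ≤ 4 * m + 1 := by omega
    simp [h3, h3']

/-- The pairs of odd difference are centred at `1 / 2` up to the difference `4 m + 3` and at
`(p + 2) / 2` from `4 m + 5` on, the pairs of even difference at `(p + 3) / 2` up to the difference
`4 m + 2` and at `1` from `4 m + 6` on; the pair `{2 m + 3, 6 m + 7}` fills the gap, and `4 m + 5`
is left over. -/
theorem exists_isSuitable_twelve_mul_add_eleven (m : ℕ) :
    ∃ x : ℕ → ZMod (12 * m + 11), IsSuitable (12 * m + 11) x ∧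
      x 2 = ((6 * m + 6 : ℕ) : ZMod _) ∧ x 3 = ((12 * m + 10 : ℕ) : ZMod _) := by
  refine ⟨_, isSuitable_of_pairs (n := 6 * m + 5) (l := 4 * m + 5)
    (X := fun i => if i % 2 = 0 then (if i ≤ 4 * m + 2 then 6 * m + 7 - i / 2
        else if i = 4 * m + 4 then 2 * m + 3 else 12 * m + 12 - i / 2)
      else if i = 1 then 0 else if i ≤ 4 * m + 3 then 12 * m + 11 - i / 2 else 6 * m + 6 - i / 2)
    (Y := fun i => if i % 2 = 0 then (if i ≤ 4 * m + 2 then 6 * m + 7 + i / 2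
        else if i = 4 * m + 4 then 6 * m + 7 else i / 2 + 1)
      else if i ≤ 4 * m + 3 then i / 2 + 1 else 6 * m + 7 + i / 2)
    (by ring) (by omega) (by omega) (by simp) ?_ ?_ ?_, ?_, ?_⟩
  · intro i _ _
    split_ifs <;> omega
  · intro i _ _
    split_ifs <;> omega
  · intro v hv hvl
    by_cases c1 : v ≤ 2 * m + 2
    · by_cases c0 : v = 0
      · exact ⟨1, by omega, by omega, by simp [c0]⟩
      · exact ⟨2 * v - 1, by omega, by omega, by right; split_ifs <;> omega⟩
    by_cases c2 : v = 2 * m + 3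
    · exact ⟨4 * m + 4, by omega, by omega, by left; split_ifs <;> omega⟩
    by_cases c3 : v ≤ 3 * m + 3
    · exact ⟨2 * (v - 1), by omega, by omega, by right; split_ifs <;> omega⟩
    by_cases c4 : v ≤ 4 * m + 4
    · exact ⟨2 * (6 * m + 6 - v) + 1, by omega, by omega, by left; split_ifs <;> omega⟩
    by_cases c5 : v ≤ 6 * m + 6
    · exact ⟨2 * (6 * m + 7 - v), by omega, by omega, by left; split_ifs <;> omega⟩
    by_cases c6 : v = 6 * m + 7
    · exact ⟨4 * m + 4, by omega, by omega, by right; split_ifs <;> omega⟩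
    by_cases c7 : v ≤ 8 * m + 8
    · exact ⟨2 * (v - (6 * m + 7)), by omega, by omega, by right; split_ifs <;> omega⟩
    by_cases c8 : v ≤ 9 * m + 9
    · exact ⟨2 * (v - (6 * m + 7)) + 1, by omega, by omega, by right; split_ifs <;> omega⟩
    by_cases c9 : v ≤ 10 * m + 9
    · exact ⟨2 * (12 * m + 12 - v), by omega, by omega, by left; split_ifs <;> omega⟩
    · exact ⟨2 * (12 * m + 11 - v) + 1, by omega, by omega, by left; split_ifs <;> omega⟩
  · have h2 : 2 ≤ 6 * m + 5 := by omega
    have h2' : 2 ≤ 4 * m + 2 := by omega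
    simp [h2, h2']
  · have h3 : 3 ≤ 6 * m + 5 := by omega
    have h3' : 3 ≤ 4 * m + 3 := by omega
    simp [h3, h3']

theorem exists_isSuitable {p : ℕ} (hp : p.Prime) (hmod : p % 4 = 3) (hp3 : 3 < p) :
    ∃ x : ℕ → ZMod p, IsSuitable p x ∧ x 2 = (((p + 1) / 2 : ℕ) : ZMod p) ∧
      (7 < p → x 3 = ((p - 1 : ℕ) : ZMod p)) ∧ x (p - 1) = 1 := by
  have hlast : ∀ x : ℕ → ZMod p, IsSuitable p x → x (p - 1) = 1 := by
    intro x hx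
    rw [← hx.add_eq 1 le_rfl (by omega), hx.first]
    simp
  -- Since `3 ∤ p`, only the residues `7` and `11` modulo `12` occur.
  have h3 : p % 3 ≠ 0 := fun h => by
    have := (Nat.prime_dvd_prime_iff_eq Nat.prime_three hp).1 (Nat.dvd_of_mod_eq_zero h)
    omega
  obtain ⟨m, rfl | rfl⟩ : ∃ m, p = 12 * m + 7 ∨ p = 12 * m + 11 := ⟨p / 12, by omega⟩
  · obtain ⟨x, hx, hx2, hx3⟩ := exists_isSuitable_twelve_mul_add_seven m
    refine ⟨x, hx, ?_, fun h => ?_, hlast x hx⟩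
    · rw [hx2]
      congr 1
      omega
    · exact hx3 (by omega)
  · obtain ⟨x, hx, hx2, hx3⟩ := exists_isSuitable_twelve_mul_add_eleven m
    refine ⟨x, hx, ?_, fun h => hx3, hlast x hx⟩
    rw [hx2]
    congr 1
    omega

/-! ### Coordinates on `H₁` -/

section Coordinates

variable {p : ℕ}

/-- Reduction `ℤ/p² → ℤ/p`. -/
def redHom (p : ℕ) : ZMod (p ^ 2) →+* ZMod p :=
  ZMod.castHom (dvd_pow_self p two_ne_zero) (ZMod p)

/-- Multiplication by `p`, as an embedding of `ℤ/p` into `ℤ/p²`. -/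
def mulP (p : ℕ) : ZMod p →+ ZMod (p ^ 2) :=
  ZMod.lift p ⟨(AddMonoidHom.mulLeft (p : ZMod (p ^ 2))).comp (Int.castAddHom _), by
    have : (p : ZMod (p ^ 2)) * p = ((p ^ 2 : ℕ) : ZMod (p ^ 2)) := by
      push_cast
      ring
    simp [this]⟩

theorem mulP_intCast (n : ℤ) : mulP p n = p * n := by
  simp [mulP]

theorem mulP_natCast (n : ℕ) : mulP p n = p * n := by
  exact_mod_cast mulP_intCast (p := p) n

theorem mulP_one : mulP p 1 = p := by
  simpa using mulP_natCast (p := p) 1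

theorem mul_mulP (u : ZMod (p ^ 2)) (s : ZMod p) : u * mulP p s = mulP p (redHom p u * s) := by
  obtain ⟨n, rfl⟩ := ZMod.intCast_surjective u
  obtain ⟨m, rfl⟩ := ZMod.intCast_surjective s
  rw [map_intCast (redHom p), ← Int.cast_mul, mulP_intCast, mulP_intCast]
  push_cast
  ring

@[simp]
theorem redHom_mulP (s : ZMod p) : redHom p (mulP p s) = 0 := by
  obtain ⟨m, rfl⟩ := ZMod.intCast_surjective s
  rw [mulP_intCast]
  simp

theorem mulP_mul_mulP (s t : ZMod p) : mulP p s * mulP p t = 0 := by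
  rw [mul_mulP, redHom_mulP, zero_mul, map_zero]

theorem mulP_injective [NeZero p] : Function.Injective (mulP p) := by
  rw [injective_iff_map_eq_zero]
  intro s hs
  obtain ⟨m, rfl⟩ := ZMod.intCast_surjective s
  rw [mulP_intCast, ← Int.cast_natCast, ← Int.cast_mul, ZMod.intCast_zmod_eq_zero_iff_dvd] at hs
  rw [ZMod.intCast_zmod_eq_zero_iff_dvd]
  push_cast at hs
  rw [pow_two] at hs
  exact Int.dvd_of_mul_dvd_mul_left (by exact_mod_cast NeZero.ne p) hs

theorem exists_mulP_eq {u : ZMod (p ^ 2)} (hu : redHom p u = 0) : ∃ s, mulP p s = u := by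
  obtain ⟨n, rfl⟩ := ZMod.intCast_surjective u
  rw [map_intCast, ZMod.intCast_zmod_eq_zero_iff_dvd] at hu
  obtain ⟨m, rfl⟩ := hu
  exact ⟨m, by rw [mulP_intCast]; push_cast; rfl⟩

theorem one_add_natCast_pow (n : ℕ) : ((p : ZMod (p ^ 2)) + 1) ^ n = 1 + mulP p n := by
  induction n with
  | zero => simp
  | succ n ih =>
    have h := mulP_mul_mulP (p := p) n 1
    rw [mulP_one] at h
    rw [pow_succ (_ + 1), ih, Nat.cast_succ, map_add, mulP_one]
    linear_combination h

/-- The set `ℤ/p² × ℤ/p`; the pair `(u, j)` stands for `b ^ j * a ^ u`. -/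
@[ext]
structure Coord (p : ℕ) where
  /-- The exponent of `a`. -/
  u : ZMod (p ^ 2)
  /-- The exponent of `b`. -/
  j : ZMod p

namespace Coord

instance : Mul (Coord p) := ⟨fun m n => ⟨m.u + n.u + m.u * mulP p n.j, m.j + n.j⟩⟩
instance : One (Coord p) := ⟨⟨0, 0⟩⟩
instance : Inv (Coord p) := ⟨fun m => ⟨-m.u + m.u * mulP p m.j, -m.j⟩⟩

@[simp] theorem mul_u (m n : Coord p) : (m * n).u = m.u + n.u + m.u * mulP p n.j := rfl
@[simp] theorem mul_j (m n : Coord p) : (m * n).j = m.j + n.j := rfl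
@[simp] theorem one_u : (1 : Coord p).u = 0 := rfl
@[simp] theorem one_j : (1 : Coord p).j = 0 := rfl
@[simp] theorem inv_u (m : Coord p) : m⁻¹.u = -m.u + m.u * mulP p m.j := rfl
@[simp] theorem inv_j (m : Coord p) : m⁻¹.j = -m.j := rfl

instance : Group (Coord p) :=
  Group.ofLeftAxioms
    (fun m n k => by
      ext
      · simp only [mul_u, mul_j, map_add]
        linear_combination m.u * mulP_mul_mulP n.j k.j
      · simp [add_assoc])
    (fun m => by ext <;> simp)
    (fun m => by
      ext
      · simp only [mul_u, inv_u, one_u]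
        linear_combination m.u * mulP_mul_mulP m.j m.j
      · simp)

theorem mk_zero_pow (u : ZMod (p ^ 2)) (n : ℕ) : (⟨u, 0⟩ : Coord p) ^ n = ⟨n * u, 0⟩ := by
  induction n with
  | zero => ext <;> simp
  | succ n ih =>
    rw [pow_succ, ih]
    ext
    · simp [add_mul]
    · simp

/-- On pairs with first coordinate in `p ℤ/p²` the multiplication is additive. -/
theorem mk_mulP_pow (w j : ZMod p) (n : ℕ) :
    (⟨mulP p w, j⟩ : Coord p) ^ n = ⟨mulP p (n * w), n * j⟩ := by
  induction n with
  | zero => ext <;> simp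
  | succ n ih =>
    rw [pow_succ, ih]
    ext
    · simp [mulP_mul_mulP, add_mul]
    · simp [add_mul]

/-- `Coord p` is in bijection with `ℤ/p² × ℤ/p`. -/
def equivProd (p : ℕ) : Coord p ≃ ZMod (p ^ 2) × ZMod p where
  toFun m := (m.u, m.j)
  invFun m := ⟨m.1, m.2⟩
  left_inv _ := rfl
  right_inv _ := rfl

theorem natCard : Nat.card (Coord p) = p ^ 3 := by
  rw [Nat.card_congr (equivProd p), Nat.card_prod, Nat.card_zmod, Nat.card_zmod]
  ring

end Coord

theorem H1.a_pow : H1.a p ^ (p ^ 2) = 1 :=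
  PresentedGroup.one_of_mem (rels := H1Rels p) (x := FreeGroup.of 0 ^ (p ^ 2)) (by simp [H1Rels])

theorem H1.b_pow : H1.b p ^ p = 1 :=
  PresentedGroup.one_of_mem (rels := H1Rels p) (x := FreeGroup.of 1 ^ p) (by simp [H1Rels])

theorem H1.a_mul_b : H1.a p * H1.b p = H1.b p * H1.a p ^ (p + 1) := by
  rw [← mul_inv_eq_one]
  exact PresentedGroup.one_of_mem (rels := H1Rels p)
    (x := (FreeGroup.of 0 * FreeGroup.of 1) * (FreeGroup.of 1 * FreeGroup.of 0 ^ (p + 1))⁻¹)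
    (by simp [H1Rels])

theorem H1.a_pow_mul_b_pow (m n : ℕ) :
    H1.a p ^ m * H1.b p ^ n = H1.b p ^ n * H1.a p ^ (m * (p + 1) ^ n) := by
  induction n with
  | zero => simp
  | succ n ih =>
    have h : SemiconjBy (H1.b p) (H1.a p ^ (p + 1)) (H1.a p) := H1.a_mul_b.symm
    have h' := (h.pow_right (m * (p + 1) ^ n)).eq
    rw [pow_succ, ← mul_assoc, ih, mul_assoc, ← h', ← mul_assoc, ← pow_mul]
    congr 2
    ring

theorem pow_val_natCast {G : Type*} [Monoid G] {g : G} {n : ℕ} (hg : g ^ n = 1) (k : ℕ) :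
    g ^ (k : ZMod n).val = g ^ k := by
  rw [ZMod.val_natCast, ← pow_eq_pow_mod k hg]

/-- The homomorphism `(u, j) ↦ b ^ j * a ^ u`. -/
def ofCoord (p : ℕ) [NeZero p] : Coord p →* H1 p :=
  MonoidHom.mk' (fun m => H1.b p ^ m.j.val * H1.a p ^ m.u.val) fun m n => by
    have hj : m.j + n.j = ((m.j.val + n.j.val : ℕ) : ZMod p) := by simp
    have hu : m.u + n.u + m.u * mulP p n.j =
        ((m.u.val * (p + 1) ^ n.j.val + n.u.val : ℕ) : ZMod (p ^ 2)) := by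
      push_cast
      rw [one_add_natCast_pow]
      simp only [ZMod.natCast_zmod_val]
      ring
    rw [Coord.mul_j, Coord.mul_u, hj, hu, pow_val_natCast H1.b_pow, pow_val_natCast H1.a_pow,
      pow_add, pow_add, mul_assoc, mul_assoc, ← mul_assoc (H1.a p ^ m.u.val),
      H1.a_pow_mul_b_pow, mul_assoc]

/-- The homomorphism `a ↦ (1, 0)`, `b ↦ (0, 1)`. -/
def toCoord (p : ℕ) : H1 p →* Coord p :=
  PresentedGroup.toGroup (f := ![⟨1, 0⟩, ⟨0, 1⟩]) (by
    rintro r (rfl | rfl | rfl)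
    · rw [map_pow, FreeGroup.lift_apply_of]
      simp only [Matrix.cons_val_zero, Coord.mk_zero_pow]
      ext
      · simp only [ZMod.natCast_self, zero_mul, Coord.one_u]
      · rfl
    · rw [map_pow, FreeGroup.lift_apply_of]
      have := Coord.mk_mulP_pow (0 : ZMod p) 1 p
      rw [map_zero] at this
      simp only [Matrix.cons_val_one, Matrix.cons_val_zero, this]
      ext <;> simp
    · rw [map_mul, map_inv, mul_inv_eq_one, map_mul, map_mul, map_pow, FreeGroup.lift_apply_of,
        FreeGroup.lift_apply_of]
      simp only [Matrix.cons_val_one, Matrix.cons_val_zero, Coord.mk_zero_pow]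
      ext
      · simp [mulP_one, add_comm]
      · simp)

theorem toCoord_a : toCoord p (H1.a p) = ⟨1, 0⟩ := PresentedGroup.toGroup.of _

theorem toCoord_b : toCoord p (H1.b p) = ⟨0, 1⟩ := PresentedGroup.toGroup.of _

/-- `H₁` is isomorphic to `ℤ/p² × ℤ/p` with
`(u, j) * (u', j') = (u + u' + p u j', j + j')`. -/
def coord (p : ℕ) [NeZero p] : H1 p ≃* Coord p :=
  MonoidHom.toMulEquiv (toCoord p) (ofCoord p)
    (PresentedGroup.ext fun i => by
      fin_cases i
      · change ofCoord p (toCoord p (H1.a p)) = H1.a p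
        rw [toCoord_a]
        change H1.b p ^ (0 : ZMod p).val * H1.a p ^ (1 : ZMod (p ^ 2)).val = _
        have := pow_val_natCast (H1.a_pow (p := p)) 1
        simp only [Nat.cast_one, pow_one] at this
        simp [this]
      · change ofCoord p (toCoord p (H1.b p)) = H1.b p
        rw [toCoord_b]
        change H1.b p ^ (1 : ZMod p).val * H1.a p ^ (0 : ZMod (p ^ 2)).val = _
        have := pow_val_natCast (H1.b_pow (p := p)) 1
        simp only [Nat.cast_one, pow_one] at this
        simp [this])
    (MonoidHom.ext fun m => by
      change toCoord p (H1.b p ^ m.j.val * H1.a p ^ m.u.val) = m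
      have := Coord.mk_mulP_pow (0 : ZMod p) 1 m.j.val
      rw [map_zero] at this
      rw [map_mul, map_pow, map_pow, toCoord_a, toCoord_b, this, Coord.mk_zero_pow]
      ext <;> simp)

variable [NeZero p]

@[simp] theorem coord_a : coord p (H1.a p) = ⟨1, 0⟩ := toCoord_a

@[simp] theorem coord_b : coord p (H1.b p) = ⟨0, 1⟩ := toCoord_b

theorem H1.natCard : Nat.card (H1 p) = p ^ 3 := by
  rw [Nat.card_congr (coord p).toEquiv, Coord.natCard]

instance : Finite (H1 p) :=
  Nat.finite_of_card_ne_zero (by rw [H1.natCard]; exact pow_ne_zero 3 (NeZero.ne p))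

theorem coord_a_pow (n : ℕ) : coord p (H1.a p ^ n) = ⟨n, 0⟩ := by
  rw [map_pow, coord_a, Coord.mk_zero_pow, mul_one]

theorem coord_a_pow_mul (n : ℕ) : coord p (H1.a p ^ (p * n)) = ⟨mulP p n, 0⟩ := by
  rw [coord_a_pow, mulP_natCast, Nat.cast_mul]

/-- The homomorphism from `H₁` to `ℤ/p` with kernel `L` that counts the exponent of `a`. -/
def exponentA (p : ℕ) [NeZero p] : H1 p →* Multiplicative (ZMod p) :=
  MonoidHom.mk' (fun h => Multiplicative.ofAdd (redHom p (coord p h).u)) fun h k => by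
    simp [← ofAdd_add]

theorem mem_L_iff {h : H1 p} : h ∈ H1.L p ↔ redHom p (coord p h).u = 0 := by
  constructor
  · intro hh
    have hle : H1.L p ≤ (exponentA p).ker := by
      rw [H1.L, Subgroup.closure_le]
      rintro k (rfl | rfl)
      · change Multiplicative.ofAdd (redHom p (coord p _).u) = 1
        have := coord_a_pow_mul (p := p) 1
        rw [mul_one] at this
        simp [this]
      · change Multiplicative.ofAdd (redHom p (coord p _).u) = 1
        simp
    exact Multiplicative.ofAdd.injective (hle hh)
  · intro hh
    obtain ⟨s, hs⟩ := exists_mulP_eq hh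
    have : h = H1.b p ^ (coord p h).j.val * (H1.a p ^ p) ^ s.val := by
      apply (coord p).injective
      have hb := Coord.mk_mulP_pow (0 : ZMod p) 1 (coord p h).j.val
      rw [map_zero] at hb
      rw [← pow_mul, map_mul, coord_a_pow_mul, map_pow, coord_b, hb]
      ext <;> simp [hs]
    rw [this]
    exact mul_mem (pow_mem (Subgroup.subset_closure (by simp)) _)
      (pow_mem (Subgroup.subset_closure (by simp)) _)

end Coordinates

/-! ### Slopes of a suitable sequence -/

/-- The slope of the basic sets of `H₁` in the coset `a ^ r L`, in the coordinates `coord`. It is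
`x r + r` rather than `x r` because these coordinates write `b` to the left of `a`. -/
def lineSlope {p : ℕ} (x : ℕ → ZMod p) (r : ZMod p) : ZMod p := x r.val + r

/-- The properties of the slopes of a suitable sequence that make the lines with these slopes the
basic sets of a Schur ring: `neg` gives closure under inversion, and both together give closure
under multiplication. The value `y 0` plays no role. -/
structure IsSlope {p : ℕ} (y : ZMod p → ZMod p) : Prop where
  inj : ∀ i j, i ≠ 0 → j ≠ 0 → y i = y j → i = j
  neg : ∀ i, i ≠ 0 → y (-i) = y i - i

theorem IsSuitable.injOn {p : ℕ} [Fact p.Prime] {x : ℕ → ZMod p} (hx : IsSuitable p x) :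
    Set.InjOn x (Set.Icc 1 (p - 1)) := by
  obtain ⟨l, hl⟩ := hx.image_eq
  refine Set.injOn_of_ncard_image_eq ?_ (Set.toFinite _)
  rw [hl, Set.ncard_compl, Set.ncard_singleton, Nat.card_zmod, Set.ncard_eq_toFinset_card']
  simp

theorem IsSuitable.add_eq_sub {p : ℕ} [Fact p.Prime] (h2 : p ≠ 2) {x : ℕ → ZMod p}
    (hx : IsSuitable p x) {i : ℕ} (h1 : 1 ≤ i) (hi : i ≤ p - 1) : x i + i = x (p - i) := by
  have hodd := (Fact.out : p.Prime).eq_two_or_odd.resolve_left h2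
  by_cases h : i ≤ (p - 1) / 2
  · exact hx.add_eq i h1 h
  · have h' := hx.add_eq (p - i) (by omega) (by omega)
    rw [show p - (p - i) = i by omega, Nat.cast_sub (by omega), CharP.cast_eq_zero] at h'
    linear_combination -h'

theorem IsSuitable.lineSlope_eq {p : ℕ} [Fact p.Prime] (h2 : p ≠ 2) {x : ℕ → ZMod p}
    (hx : IsSuitable p x) {r : ZMod p} (hr : r ≠ 0) : lineSlope x r = x (p - r.val) := by
  have h1 : r.val ≠ 0 := by simpa using hr
  have hlt := ZMod.val_lt r
  rw [lineSlope, ← hx.add_eq_sub h2 (by omega) (by omega), ZMod.natCast_zmod_val]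

theorem IsSuitable.isSlope {p : ℕ} [Fact p.Prime] (h2 : p ≠ 2) {x : ℕ → ZMod p}
    (hx : IsSuitable p x) : IsSlope (lineSlope x) where
  inj i j hi hj h := by
    rw [hx.lineSlope_eq h2 hi, hx.lineSlope_eq h2 hj] at h
    have hi' : i.val ≠ 0 := by simpa using hi
    have hj' : j.val ≠ 0 := by simpa using hj
    have hil := ZMod.val_lt i
    have hjl := ZMod.val_lt j
    have := hx.injOn ⟨by omega, by omega⟩ ⟨by omega, by omega⟩ h
    exact ZMod.val_injective p (by omega)
  neg i hi := by
    have : NeZero i := ⟨hi⟩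
    have hil := ZMod.val_lt i
    rw [hx.lineSlope_eq h2 (neg_ne_zero.2 hi), ZMod.val_neg_of_ne_zero,
      show p - (p - i.val) = i.val by omega, lineSlope]
    ring

theorem IsSuitable.lineSlope_one {p : ℕ} [Fact p.Prime] {x : ℕ → ZMod p} (hx : IsSuitable p x) :
    lineSlope x 1 = 1 := by
  rw [lineSlope, ZMod.val_one, hx.first, zero_add]

theorem two_mul_lineSlope_two {p : ℕ} [Fact p.Prime] (hp : 2 < p) {x : ℕ → ZMod p}
    (hx2 : x 2 = (((p + 1) / 2 : ℕ) : ZMod p)) : 2 * lineSlope x 2 = 5 := by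
  have hodd := (Fact.out : p.Prime).eq_two_or_odd.resolve_left hp.ne'
  have hval : (2 : ZMod p).val = 2 := by exact_mod_cast ZMod.val_cast_of_lt (n := p) hp
  have h : ((2 * ((p + 1) / 2) : ℕ) : ZMod p) = 1 := by
    rw [show 2 * ((p + 1) / 2) = p + 1 by omega]
    simp
  push_cast at h
  rw [lineSlope, hval, hx2]
  linear_combination h

/-! ### The partition of `H₁` into lines -/

section Lines

variable {p : ℕ} [NeZero p]

/-- The line in `H₁` of slope `y r` through `a ^ u`, where `r` is the residue of `u` mod `p`. -/
def line (y : ZMod p → ZMod p) (u : ZMod (p ^ 2)) : Set (H1 p) :=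
  Set.range fun t : ZMod p => (coord p).symm ⟨u + mulP p (y (redHom p u) * t), t⟩

/-- The points of `L` and the lines with slopes `y` in the other cosets of `L`. -/
def lineFamily (y : ZMod p → ZMod p) : Set (Set (H1 p)) :=
  {S | ∃ l, redHom p (coord p l).u = 0 ∧ S = {l}} ∪ {S | ∃ u, redHom p u ≠ 0 ∧ S = line y u}

variable {y : ZMod p → ZMod p}

theorem mem_line {u : ZMod (p ^ 2)} {h : H1 p} :
    h ∈ line y u ↔ (coord p h).u = u + mulP p (y (redHom p u) * (coord p h).j) := by
  constructor
  · rintro ⟨t, rfl⟩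
    simp
  · intro hh
    exact ⟨(coord p h).j, (coord p).injective (by ext <;> simp [hh])⟩

theorem redHom_of_mem_line {u : ZMod (p ^ 2)} {h : H1 p} (hh : h ∈ line y u) :
    redHom p (coord p h).u = redHom p u := by
  rw [mem_line.1 hh]
  simp

theorem line_injective (y : ZMod p → ZMod p) (u : ZMod (p ^ 2)) : Function.Injective
    fun t : ZMod p => (coord p).symm ⟨u + mulP p (y (redHom p u) * t), t⟩ :=
  fun _ _ h => congrArg Coord.j ((coord p).symm.injective h)

theorem simpleQuantity_line (y : ZMod p → ZMod p) (u : ZMod (p ^ 2)) :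
    simpleQuantity (line y u) = ∑ t : ZMod p, MonoidAlgebra.single
      ((coord p).symm ⟨u + mulP p (y (redHom p u) * t), t⟩) (1 : ℚ) :=
  simpleQuantity_range (line_injective y u)

theorem singleton_mem_lineFamily {l : H1 p} (hl : redHom p (coord p l).u = 0) :
    {l} ∈ lineFamily y :=
  Or.inl ⟨l, hl, rfl⟩

theorem line_mem_lineFamily {u : ZMod (p ^ 2)} (hu : redHom p u ≠ 0) :
    line y u ∈ lineFamily y :=
  Or.inr ⟨u, hu, rfl⟩

theorem isPartition_lineFamily (y : ZMod p → ZMod p) : Setoid.IsPartition (lineFamily y) := by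
  constructor
  · rintro (⟨l, -, h⟩ | ⟨u, -, h⟩)
    · exact Set.singleton_ne_empty l h.symm
    · exact (Set.range_nonempty _).ne_empty h.symm
  · intro h
    by_cases hh : redHom p (coord p h).u = 0
    · refine ⟨{h}, ⟨singleton_mem_lineFamily hh, rfl⟩, ?_⟩
      rintro S ⟨⟨l, -, rfl⟩ | ⟨u, hu, rfl⟩, hS⟩
      · rw [Set.mem_singleton_iff.1 hS]
      · exact absurd (redHom_of_mem_line hS ▸ hh) hu
    · set u := (coord p h).u - mulP p (y (redHom p (coord p h).u) * (coord p h).j) with hu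
      have hred : redHom p u = redHom p (coord p h).u := by simp [hu]
      refine ⟨line y u, ⟨line_mem_lineFamily (hred ▸ hh), ?_⟩, ?_⟩
      · rw [mem_line, hred, hu, sub_add_cancel]
      · rintro S ⟨⟨l, hl, rfl⟩ | ⟨v, hv, rfl⟩, hS⟩
        · rw [Set.mem_singleton_iff.1 hS] at hh
          exact absurd hl hh
        · have : v = u := by
            rw [hu, redHom_of_mem_line hS, mem_line.1 hS, add_sub_cancel_right]
          rw [this]

/-- Along a basic set outside `L` the intercept `u - p y(r) j` is constant. -/
theorem intercept_eq_of_mem_lineFamily {S : Set (H1 p)} (hS : S ∈ lineFamily y) {h k : H1 p}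
    (hh : h ∈ S) (hk : k ∈ S) (h0 : redHom p (coord p h).u ≠ 0) :
    (coord p k).u - mulP p (y (redHom p (coord p h).u) * (coord p k).j) =
      (coord p h).u - mulP p (y (redHom p (coord p h).u) * (coord p h).j) := by
  obtain ⟨l, hl, rfl⟩ | ⟨u, hu, rfl⟩ := hS
  · rw [Set.mem_singleton_iff.1 hh] at h0
    exact absurd hl h0
  · rw [redHom_of_mem_line hh, mem_line.1 hh, mem_line.1 hk]
    simp

theorem ncard_of_mem_lineFamily {S : Set (H1 p)} (hS : S ∈ lineFamily y) :
    ∃ n : ℕ, S.ncard = p ^ n := by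
  obtain ⟨l, -, rfl⟩ | ⟨u, -, rfl⟩ := hS
  · exact ⟨0, by simp⟩
  · refine ⟨1, ?_⟩
    rw [line, Set.ncard_range_of_injective (line_injective y u), Nat.card_zmod, pow_one]

theorem coord_mul_pow_mul {x : ℕ → ZMod p} (i j n : ℕ) :
    coord p (H1.a p ^ i * (H1.b p * H1.a p ^ (p * (x i).val)) ^ n * H1.a p ^ (p * j)) =
      ⟨i + mulP p j + mulP p ((x i + i) * n), n⟩ := by
  have hc : coord p (H1.b p * H1.a p ^ (p * (x i).val)) = ⟨mulP p (x i), 1⟩ := by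
    rw [map_mul, coord_b, coord_a_pow_mul]
    ext <;> simp
  rw [map_mul, map_mul, coord_a_pow, map_pow, hc, Coord.mk_mulP_pow, coord_a_pow_mul]
  ext
  · have := mul_mulP (p := p) i n
    rw [map_natCast (redHom p)] at this
    have e : (x i + i) * n = n * x i + i * n := by ring
    simp only [Coord.mul_u, map_zero, mul_zero, add_zero, mul_one, e, map_add]
    linear_combination this
  · simp

theorem T_mul_eq_line {x : ℕ → ZMod p} {i : ℕ} (hi : i < p) (j : ℕ) :
    H1.T p x i * {H1.a p ^ (p * j)} = line (lineSlope x) (i + mulP p j) := by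
  have hred : redHom p (i + mulP p j) = i := by simp
  have hs' : lineSlope x (i : ZMod p) = x i + i := by rw [lineSlope, ZMod.val_cast_of_lt hi]
  ext h
  rw [line, hred, hs', Set.mul_singleton, H1.T, Set.singleton_mul, Set.image_image]
  constructor
  · rintro ⟨c, hc, rfl⟩
    obtain ⟨n, rfl⟩ := mem_powers_iff_mem_zpowers.2 hc
    exact ⟨n, by dsimp only; rw [MulEquiv.symm_apply_eq, coord_mul_pow_mul]⟩
  · rintro ⟨t, rfl⟩
    refine ⟨_, mem_powers_iff_mem_zpowers.1 ⟨t.val, rfl⟩, ?_⟩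
    dsimp only
    rw [MulEquiv.eq_symm_apply, coord_mul_pow_mul]
    simp

theorem basicSets_eq_lineFamily (x : ℕ → ZMod p) :
    H1.basicSets p x = lineFamily (lineSlope x) := by
  ext S
  refine or_congr (exists_congr fun l => and_congr_left fun _ => mem_L_iff) ⟨?_, ?_⟩
  · rintro ⟨i, j, hi1, hi2, -, rfl⟩
    refine ⟨i + mulP p j, ?_, T_mul_eq_line (by omega) j⟩
    have : redHom p (i + mulP p j) = i := by simp
    rw [this]
    exact natCast_ne_zero_of_lt (by omega) (by omega)
  · rintro ⟨u, hu, rfl⟩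
    obtain ⟨s, hs⟩ : ∃ s, mulP p s = u - ((redHom p u).val : ℕ) :=
      exists_mulP_eq (by simp)
    have hlt := ZMod.val_lt (redHom p u)
    have hslt := ZMod.val_lt s
    have h0 : (redHom p u).val ≠ 0 := by simpa using hu
    refine ⟨(redHom p u).val, s.val, by omega, by omega, by omega, ?_⟩
    rw [T_mul_eq_line hlt, ZMod.natCast_zmod_val s, hs, add_sub_cancel]

end Lines

/-! ### The Schur ring -/

section SchurRing

variable {p : ℕ} [Fact p.Prime] {y : ZMod p → ZMod p}

theorem single_mem_spanOf_lineFamily {l : H1 p} (hl : redHom p (coord p l).u = 0) :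
    MonoidAlgebra.single l (1 : ℚ) ∈ spanOf (lineFamily y) := by
  rw [← simpleQuantity_singleton]
  exact Submodule.subset_span ⟨_, singleton_mem_lineFamily hl, rfl⟩

theorem simpleQuantity_line_mem {u : ZMod (p ^ 2)} (hu : redHom p u ≠ 0) :
    simpleQuantity (line y u) ∈ spanOf (lineFamily y) :=
  Submodule.subset_span ⟨_, line_mem_lineFamily hu, rfl⟩

theorem single_mul_line {l : H1 p} (hl : redHom p (coord p l).u = 0) (u : ZMod (p ^ 2)) :
    MonoidAlgebra.single l (1 : ℚ) * simpleQuantity (line y u) = simpleQuantity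
      (line y (u + (coord p l).u - mulP p (y (redHom p u) * (coord p l).j))) := by
  have hred : redHom p (u + (coord p l).u - mulP p (y (redHom p u) * (coord p l).j)) =
      redHom p u := by simp [hl]
  rw [simpleQuantity_line, simpleQuantity_line, hred, Finset.mul_sum]
  refine Fintype.sum_equiv (Equiv.addLeft (coord p l).j) _ _ fun t => ?_
  rw [MonoidAlgebra.single_mul_single, mul_one]
  congr 1
  rw [MulEquiv.eq_symm_apply, map_mul, MulEquiv.apply_symm_apply]
  ext
  · simp only [Coord.mul_u, mul_mulP, hl, Equiv.coe_addLeft, mul_add, map_add, zero_mul, map_zero]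
    ring
  · simp

theorem line_mul_single {l : H1 p} (hl : redHom p (coord p l).u = 0) (u : ZMod (p ^ 2)) :
    simpleQuantity (line y u) * MonoidAlgebra.single l (1 : ℚ) = simpleQuantity
      (line y (u + (coord p l).u + mulP p ((redHom p u - y (redHom p u)) * (coord p l).j))) := by
  have hred : redHom p (u + (coord p l).u + mulP p ((redHom p u - y (redHom p u)) *
      (coord p l).j)) = redHom p u := by simp [hl]
  rw [simpleQuantity_line, simpleQuantity_line, hred, Finset.sum_mul]
  refine Fintype.sum_equiv (Equiv.addRight (coord p l).j) _ _ fun t => ?_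
  rw [MonoidAlgebra.single_mul_single, mul_one]
  congr 1
  rw [MulEquiv.eq_symm_apply, map_mul, MulEquiv.apply_symm_apply]
  ext
  · simp only [Coord.mul_u, mul_mulP, Equiv.coe_addRight, mul_add, sub_mul, map_add, map_sub,
      redHom_mulP, add_zero]
    ring
  · simp

theorem line_mul_line (u v : ZMod (p ^ 2)) :
    simpleQuantity (line y u) * simpleQuantity (line y v) =
      ∑ t : ZMod p, ∑ s : ZMod p, MonoidAlgebra.single ((coord p).symm
        ⟨u + v + mulP p (y (redHom p u) * t + (y (redHom p v) + redHom p u) * s), t + s⟩)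
        (1 : ℚ) := by
  rw [simpleQuantity_line, simpleQuantity_line, Fintype.sum_mul_sum]
  refine Finset.sum_congr rfl fun t _ => Finset.sum_congr rfl fun s _ => ?_
  rw [MonoidAlgebra.single_mul_single, mul_one, ← map_mul]
  congr 2
  ext
  · simp only [Coord.mul_u, mul_mulP, map_add, redHom_mulP, map_zero, add_zero, add_mul, zero_mul]
    ring
  · simp

/-- The product of two lines outside `L` whose product avoids `L` is a full coset of `L`, each
point of which is attained once, because `y u ≠ y v + u`. -/
theorem line_mul_line_eq_sum (hy : IsSlope y) {u v : ZMod (p ^ 2)} (hu : redHom p u ≠ 0)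
    (hv : redHom p v ≠ 0) (huv : redHom p (u + v) ≠ 0) :
    simpleQuantity (line y u) * simpleQuantity (line y v) =
      ∑ c : ZMod p, simpleQuantity (line y (u + v + mulP p c)) := by
  have hne : y (redHom p u) - (y (redHom p v) + redHom p u) ≠ 0 := fun h => by
    have := hy.inj (-redHom p u) (redHom p v) (neg_ne_zero.2 hu) hv (by
      rw [hy.neg _ hu]
      linear_combination h)
    rw [map_add, ← this] at huv
    simp at huv
  set r := redHom p (u + v) with hr
  have hred : ∀ c, redHom p (u + v + mulP p c) = r := fun c => by
    rw [map_add, redHom_mulP, add_zero]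
  -- `f (t, s)` is the intercept and the second coordinate of the product of the points with
  -- parameters `t` and `s`.
  let f : ZMod p × ZMod p → ZMod p × ZMod p := fun z =>
    ((y (redHom p u) - y r) * z.1 + (y (redHom p v) + redHom p u - y r) * z.2, z.1 + z.2)
  have hf : Function.Bijective f := by
    rw [← Finite.injective_iff_bijective]
    rintro ⟨t, s⟩ ⟨t', s'⟩ h
    have h1 := congrArg Prod.fst h
    have h2 := congrArg Prod.snd h
    simp only [f] at h1 h2
    have ht : t = t' := by
      rw [← sub_eq_zero]
      refine (mul_eq_zero.1 ?_).resolve_left hne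
      linear_combination h1 - (y (redHom p v) + redHom p u - y r) * h2
    subst ht
    rw [add_left_cancel h2]
  simp only [simpleQuantity_line y (u + v + mulP p _), hred]
  rw [line_mul_line, ← Fintype.sum_prod_type', ← Fintype.sum_prod_type']
  refine Fintype.sum_equiv (Equiv.ofBijective f hf) _ _ fun z => ?_
  congr 2
  ext
  · simp only [Equiv.ofBijective_apply, f]
    rw [add_assoc (u + v), ← map_add (mulP p)]
    congr 2
    ring
  · rfl

theorem mul_mem_spanOf_lineFamily (hy : IsSlope y) {S T : Set (H1 p)} (hS : S ∈ lineFamily y)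
    (hT : T ∈ lineFamily y) :
    simpleQuantity S * simpleQuantity T ∈ spanOf (lineFamily y) := by
  obtain ⟨l, hl, rfl⟩ | ⟨u, hu, rfl⟩ := hS <;> obtain ⟨k, hk, rfl⟩ | ⟨v, hv, rfl⟩ := hT
  · rw [simpleQuantity_singleton, simpleQuantity_singleton, MonoidAlgebra.single_mul_single,
      mul_one]
    exact single_mem_spanOf_lineFamily (by simp [hl, hk])
  · rw [simpleQuantity_singleton, single_mul_line hl]
    exact simpleQuantity_line_mem (by simpa [hl] using hv)
  · rw [simpleQuantity_singleton, line_mul_single hk]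
    exact simpleQuantity_line_mem (by simpa [hk] using hu)
  · by_cases huv : redHom p (u + v) = 0
    · rw [line_mul_line]
      exact Submodule.sum_mem _ fun t _ => Submodule.sum_mem _ fun s _ =>
        single_mem_spanOf_lineFamily (by
          rw [MulEquiv.apply_symm_apply, map_add, huv, redHom_mulP, add_zero])
    · rw [line_mul_line_eq_sum hy hu hv huv]
      exact Submodule.sum_mem _ fun c _ => simpleQuantity_line_mem (by
        rwa [map_add _ (u + v), redHom_mulP, add_zero])

theorem inv_mem_lineFamily (hy : IsSlope y) {S : Set (H1 p)} (hS : S ∈ lineFamily y) :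
    S⁻¹ ∈ lineFamily y := by
  obtain ⟨l, hl, rfl⟩ | ⟨u, hu, rfl⟩ := hS
  · rw [Set.inv_singleton]
    exact singleton_mem_lineFamily (by simp [hl])
  · have : (line y u)⁻¹ = line y (-u) := by
      ext h
      rw [Set.mem_inv, mem_line, mem_line, map_inv, Coord.inv_u, Coord.inv_j, map_neg, hy.neg _ hu]
      constructor
      · intro h'
        have hred : redHom p (coord p h).u = -redHom p u := by
          have := congrArg (redHom p) h'
          simp only [map_add, map_neg, map_mul, redHom_mulP, mul_zero, add_zero] at this
          rw [← this, neg_neg]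
        rw [mul_mulP, hred] at h'
        simp only [sub_mul, map_sub, neg_mul, mul_neg, map_neg] at h' ⊢
        linear_combination -h'
      · intro h'
        have hred : redHom p (coord p h).u = -redHom p u := by
          rw [h']
          simp
        rw [mul_mulP, hred]
        simp only [sub_mul, map_sub, neg_mul, mul_neg, map_neg] at h' ⊢
        linear_combination -h'
    rw [this]
    exact line_mem_lineFamily (by simpa using hu)

/-- The Schur ring whose basic sets are the points of `L` and the lines with slopes `y`. -/
noncomputable def lineRing (hy : IsSlope y) : Subalgebra ℚ (MonoidAlgebra ℚ (H1 p)) :=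
  (spanOf (lineFamily y)).toSubalgebra
    (by
      rw [MonoidAlgebra.one_def]
      exact single_mem_spanOf_lineFamily (by simp))
    (fun f g hf hg => by
      induction hf, hg using Submodule.span_induction₂ with
      | mem_mem f g hf hg =>
        obtain ⟨S, hS, rfl⟩ := hf
        obtain ⟨T, hT, rfl⟩ := hg
        exact mul_mem_spanOf_lineFamily hy hS hT
      | zero_left g _ =>
        rw [zero_mul]
        exact zero_mem _
      | zero_right f _ =>
        rw [mul_zero]
        exact zero_mem _
      | add_left f f' g _ _ _ h h' =>
        rw [add_mul]
        exact add_mem h h'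
      | add_right f g g' _ _ _ h h' =>
        rw [mul_add]
        exact add_mem h h'
      | smul_left c f g _ _ h =>
        rw [smul_mul_assoc]
        exact Submodule.smul_mem _ c h
      | smul_right c f g _ _ h =>
        rw [mul_smul_comm]
        exact Submodule.smul_mem _ c h)

theorem toSubmodule_lineRing (hy : IsSlope y) :
    Subalgebra.toSubmodule (lineRing hy) = spanOf (lineFamily y) :=
  Submodule.toSubalgebra_toSubmodule ..

theorem isBsets_lineRing (hy : IsSlope y) : IsBsets (lineRing hy) (lineFamily y) where
  finite := inferInstance
  isPartition := isPartition_lineFamily y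
  linearIndependent := linearIndependent_simpleQuantity (isPartition_lineFamily y)
  span_eq := (toSubmodule_lineRing hy).symm
  one_mem := singleton_mem_lineFamily (by simp)
  inv_mem _ hT := inv_mem_lineFamily hy hT

theorem isPSchurRing_lineRing (hy : IsSlope y) : IsPSchurRing p (lineRing hy) := by
  refine ⟨IsPGroup.of_card H1.natCard, ⟨_, isBsets_lineRing hy⟩, fun B hB T hT => ?_⟩
  rw [eq_of_spanOf_eq hB.isPartition (isPartition_lineFamily y)
    (hB.span_eq.trans (toSubmodule_lineRing hy))] at hT
  exact ncard_of_mem_lineFamily hT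

/-! ### The Schur ring is not Schurian -/

/-- If the Schur ring is Schurian, then some `g` in the group fixes `1` and moves `a`. It moves each
`a ^ i` along its line by an amount `t i`, and the quotients of the images of two powers of `a` lie
on prescribed lines, which are linear relations that force `t 1 = 0`. -/
theorem not_isSchurian_lineRing (hp3 : 3 < p) (hy : IsSlope y) (h1 : y 1 = 1)
    (h2 : 2 * y 2 = 5) : ¬ IsSchurian (lineRing hy) := by
  rintro ⟨G, hG, hA⟩
  rw [toSubmodule_lineRing] at hA
  have hB := eq_of_spanOf_eq (isPartition_stabilizerOrbits G) (isPartition_lineFamily y) hA.symm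
  have hline : line y 1 ∈ lineFamily y := line_mem_lineFamily (by simp)
  have ha : (coord p).symm ⟨1, 0⟩ ∈ line y 1 := by simp [mem_line]
  have ha' : (coord p).symm ⟨1 + mulP p 1, 1⟩ ∈ line y 1 := by simp [mem_line, h1]
  obtain ⟨h, hh⟩ := hB ▸ hline
  rw [← hh] at ha ha'
  dsimp only at ha ha'
  rw [← MulAction.orbit_eq_iff.2 ha] at ha'
  obtain ⟨⟨⟨g, hgG⟩, hg1⟩, hga⟩ := ha'
  replace hg1 : g 1 = 1 := hg1
  replace hga : g ((coord p).symm ⟨1, 0⟩) = (coord p).symm ⟨1 + mulP p 1, 1⟩ := hga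
  -- `g` preserves the line on which the quotient `k h⁻¹` lies.
  have hrel : ∀ h k : H1 p, redHom p (coord p (k * h⁻¹)).u ≠ 0 →
      (coord p (g k * (g h)⁻¹)).u -
        mulP p (y (redHom p (coord p (k * h⁻¹)).u) * (coord p (g k * (g h)⁻¹)).j) =
      (coord p (k * h⁻¹)).u -
        mulP p (y (redHom p (coord p (k * h⁻¹)).u) * (coord p (k * h⁻¹)).j) := by
    intro h k h0
    have hmem : MulAction.orbit (MulAction.stabilizer G (1 : H1 p)) (k * h⁻¹) ∈ lineFamily y :=
      hB ▸ ⟨_, rfl⟩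
    exact intercept_eq_of_mem_lineFamily hmem (MulAction.mem_orbit_self _)
      (apply_mul_inv_mem_orbit hG hgG h k) h0
  -- A section of the reduction: `(w i, 0)` represents `a ^ i`.
  let w : ZMod p → ZMod (p ^ 2) := fun i => (i.val : ℕ)
  have hw : ∀ i, redHom p (w i) = i := fun i => by simp [w]
  let t : ZMod p → ZMod p := fun i => (coord p (g ((coord p).symm ⟨w i, 0⟩))).j
  have hu : ∀ i, i ≠ 0 →
      (coord p (g ((coord p).symm ⟨w i, 0⟩))).u = w i + mulP p (y i * t i) := by
    intro i hi
    have h := hrel 1 ((coord p).symm ⟨w i, 0⟩)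
    rw [hg1, inv_one, mul_one, mul_one, MulEquiv.apply_symm_apply, hw] at h
    have := h hi
    rw [mul_zero, map_zero, sub_zero] at this
    exact sub_eq_iff_eq_add.1 this
  have ht : t 1 = 0 := by
    refine eq_zero_of_slope_relations hp3 hy.inj hy.neg h1 h2 fun i j hi hj hij => ?_
    have hji : j - i ≠ 0 := sub_ne_zero.2 hij.symm
    have h := hrel ((coord p).symm ⟨w i, 0⟩) ((coord p).symm ⟨w j, 0⟩)
    simp only [map_mul, map_inv, MulEquiv.apply_symm_apply, Coord.mul_u, Coord.mul_j, Coord.inv_u,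
      Coord.inv_j, map_zero, mul_zero, add_zero, neg_zero, map_add, map_neg, hw, hu i hi, hu j hj,
      sub_zero] at h
    have h' := h (by rwa [← sub_eq_add_neg])
    rw [← sub_eq_add_neg j i] at h'
    change _ - mulP p (y (j - i) * (t j + -t i)) = _ at h'
    have key : mulP p ((y j - y (j - i)) * t j) = mulP p ((y i - y (i - j)) * t i) := by
      have e : y (i - j) = y (j - i) - (j - i) := by rw [← hy.neg _ hji, neg_sub]
      have e1 := mul_mulP (p := p) (w i) (t i)
      have e2 := mul_mulP (p := p) (w j) (t i)
      have e3 := mulP_mul_mulP (p := p) (y i * t i) (t i)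
      have e4 := mulP_mul_mulP (p := p) (y j * t j) (t i)
      rw [hw] at e1 e2
      change _ + (-(w i + mulP p (y i * t i)) + (w i + mulP p (y i * t i)) * mulP p (t i)) +
        (w j + mulP p (y j * t j)) * -mulP p (t i) - _ = _ at h'
      rw [e]
      simp only [sub_mul, mul_add, map_sub, map_add, mul_neg, map_neg] at h' ⊢
      linear_combination h' - e1 + e2 - e3 + e4
    rw [mul_comm (t j), mul_comm (t i)]
    exact mulP_injective key
  have hw1 : w 1 = 1 := by simp only [w, ZMod.val_one, Nat.cast_one]
  simp only [t, hw1, hga, MulEquiv.apply_symm_apply] at ht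
  exact one_ne_zero ht

end SchurRing

theorem mainTheorem2 (p : ℕ) (hp : p.Prime) (hmod : p % 4 = 3) (hp3 : 3 < p) :
    Nat.card (H1 p) = p ^ 3 ∧
    (∃ x : ℕ → ZMod p, IsSuitable p x ∧ x 2 = (((p + 1) / 2 : ℕ) : ZMod p) ∧
      (7 < p → x 3 = ((p - 1 : ℕ) : ZMod p)) ∧ x (p - 1) = 1) ∧
    ∀ x : ℕ → ZMod p, IsSuitable p x → x 2 = (((p + 1) / 2 : ℕ) : ZMod p) →
      ∃ A : Subalgebra ℚ (MonoidAlgebra ℚ (H1 p)),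
        Subalgebra.toSubmodule A = spanOf (H1.basicSets p x) ∧
        IsBsets A (H1.basicSets p x) ∧
        IsPSchurRing p A ∧
        ¬ IsSchurian A := by
  have : Fact p.Prime := ⟨hp⟩
  refine ⟨H1.natCard, exists_isSuitable hp hmod hp3, fun x hx hx2 => ?_⟩
  have hy := hx.isSlope (by omega)
  rw [basicSets_eq_lineFamily]
  exact ⟨lineRing hy, toSubmodule_lineRing hy, isBsets_lineRing hy, isPSchurRing_lineRing hy,
    not_isSchurian_lineRing hp3 hy hx.lineSlope_one (two_mul_lineSlope_two (by omega) hx2)⟩
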